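/- Let $n\ge 2$ and let $\mathbf m=(m_1,\dots,m_n)$ be nonnegative integers, with $m^*=\max_i m_i\ge 1$ and $N=\sum_i m_i$. A deck with multiplicities $\mathbf m$ is a word of length $N$ in the letters (types) $1,\dots,n$ in which type $i$ occurs exactly $m_i$ times; it is chosen uniformly at random among all such words. A player guesses the type of the top card, the card is then revealed and removed, and this continues until no cards are left; each guess may depend on all the types revealed so far. A strategy is called best if it maximizes the expected number of correct guesses; every greedy strategy, i.e. one that always guesses a type occurring most often among the remaining cards, is best. Let $S^+_{\mathbf m}$ be the number of correct guesses under a best strategy. For $j\ge 1$ put $$\gamma_j=\Big(\frac1n\sum_{i=1}^n\binom{m_i}{j}\Big)^{1/j},\qquad H_k=1+\frac12+\dots+\frac1k .$$ Let $\epsilon\in(0,1]$ and suppose that at least a fraction $\epsilon$ of the $n$ types (in particular: exactly a fraction $\epsilon$) have multiplicity $m^*$. Then $$\mathbb E[S^+_{\mathbf m}]=H_{m^*}H_n+\sum_{j=1}^{m^*}\ln\gamma_j+O\left(\ln n\left(\frac{\ln n}{n}\right)^{1/m^*}\right),$$ where the implicit constant depends only on $m^*$ and $\epsilon$. -/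

import Mathlib

/-- The decks (words in the types `Fin n`, position `0` being the top card) in which each type `i`
occurs exactly `m i` times. A shuffled deck is a uniformly random element of this set. -/
def CardGuess.decks {n : ℕ} (m : Fin n → ℕ) : Finset (Fin (∑ i, m i) → Fin n) :=
  Finset.univ.filter fun d =>
    ∀ i, (Finset.univ.filter fun t => d t = i).card = m i

/-- A strategy for the game with complete feedback: the list of the types revealed so far
(in the order in which they were revealed) determines the next guess. -/
abbrev CardGuess.Strategy (n : ℕ) : Type := List (Fin n) → Fin n

/-- The number of correct guesses of the strategy `σ` on the deck `d`: before guessing the card at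
position `t`, the player knows the types of the `t` cards above it. -/
def CardGuess.correctGuesses {n N : ℕ} (σ : CardGuess.Strategy n) (d : Fin N → Fin n) : ℕ :=
  (Finset.univ.filter fun t : Fin N => σ ((List.ofFn d).take t) = d t).card

/-- The expected number of correct guesses of `σ` on a uniformly random deck with
multiplicities `m`. -/
noncomputable def CardGuess.expectedCorrect {n : ℕ} (m : Fin n → ℕ)
    (σ : CardGuess.Strategy n) : ℝ :=
  (∑ d ∈ CardGuess.decks m, (CardGuess.correctGuesses σ d : ℝ)) / ((CardGuess.decks m).card : ℝ)

/-- A best strategy: one that maximizes the expected number of correct guesses. -/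
def CardGuess.IsBest {n : ℕ} (m : Fin n → ℕ) (σ : CardGuess.Strategy n) : Prop :=
  ∀ τ : CardGuess.Strategy n, CardGuess.expectedCorrect m τ ≤ CardGuess.expectedCorrect m σ

/-- A greedy strategy: after every possible history `h`, the guess is a type
that occurs the most among the remaining cards. -/
def CardGuess.IsGreedy {n : ℕ} (m : Fin n → ℕ) (σ : CardGuess.Strategy n) : Prop :=
  ∀ h : List (Fin n), (∀ i, h.count i ≤ m i) →
    ∀ i, m i - h.count i ≤ m (σ h) - h.count (σ h)

/-- `γ_j = ((1/n) ∑ i, (m i choose j)) ^ (1/j)`. -/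
noncomputable def CardGuess.gammaMean {n : ℕ} (m : Fin n → ℕ) (j : ℕ) : ℝ :=
  ((1 / (n : ℝ)) * ∑ i, ((m i).choose j : ℝ)) ^ (1 / (j : ℝ))

/-- The set of decks with given multiplicities is never empty. -/
theorem CardGuess.decks_nonempty {n : ℕ} (m : Fin n → ℕ) : (CardGuess.decks m).Nonempty := by
  refine ⟨fun t => (finSigmaFinEquiv.symm t).1, ?_⟩
  simp only [CardGuess.decks, Finset.mem_filter, Finset.mem_univ, true_and]
  intro i
  have h : (Finset.univ.filter fun t : Fin (∑ i, m i) => (finSigmaFinEquiv.symm t).1 = i)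
      = (Finset.univ : Finset (Fin (m i))).image fun k => finSigmaFinEquiv ⟨i, k⟩ := by
    ext t
    simp only [Finset.mem_filter, Finset.mem_univ, true_and, Finset.mem_image]
    constructor
    · intro ht
      subst ht
      exact ⟨(finSigmaFinEquiv.symm t).2, by simp⟩
    · rintro ⟨k, rfl⟩
      simp
  rw [h, Finset.card_image_of_injective _ fun a b hab => by simpa using hab]
  simp

/-- Greedy strategies exist as soon as there is at least one type. -/
theorem CardGuess.exists_isGreedy {n : ℕ} (hn : 1 ≤ n) (m : Fin n → ℕ) :
    ∃ σ : CardGuess.Strategy n, CardGuess.IsGreedy m σ := by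
  have : Nonempty (Fin n) := ⟨⟨0, hn⟩⟩
  have H : ∀ h : List (Fin n), ∃ a : Fin n, ∀ i, m i - h.count i ≤ m a - h.count a := fun h =>
    Finite.exists_max fun i => m i - h.count i
  choose σ hσ using H
  exact ⟨σ, fun h _ => hσ h⟩

/-! Given the revealed cards, the unseen ones are exchangeable, so a guess is correct with
probability (remaining copies of the guessed type)/(remaining cards). Greedy guessing maximizes
every such term, and every best strategy has the same value `greedyValue`, an average of sums of
(largest remaining multiplicity)/(remaining cards).

Write that maximum as a sum over `j` of indicators that some type still has `j` copies. If `q j k`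
is the probability that `k` given positions hold `j` cards of one type, the value is the double sum
of `q j k / k`. Since 1/k is the integral over [0,1] of `C(N,k) p^(k-1) (1-p)^(N-k)`, the sum over
`k` equals the integral of `(1 - ∏ P(Bin(m_i,p) < j)) / p`: sampling positions independently makes
the types independent (`exists_reach_probability`).

Replace each binomial probability by `(1 - p^j)^C(m_i,j)`. With `A = ∑ C(m_i,j)` the integral
becomes exactly `H_A / j`. The error is controlled by `K`, the number of types with `m_i ≥ j`, and
is `O(K^(-1/j))` (`abs_sum_div_sub_harmonic_le`). Finally `H_A - ln A` and `H_n - ln n` are both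
close to Euler's constant, and `ln γ_j = (ln A - ln n)/j`. As `K ≥ εn`, this gives an error
`O(n^(-1/M))`, better than required. -/

namespace CardGuess

/-! ### Exchangeability of the unseen cards and optimality of greedy guessing -/

/-- The number of positions in `S` at which the deck `d` has a card of type `i`. -/
def hits {n N : ℕ} (d : Fin N → Fin n) (S : Finset (Fin N)) (i : Fin n) : ℕ :=
  (S.filter fun s => d s = i).card

theorem sum_decks_comp {n : ℕ} (m : Fin n → ℕ) (e : Equiv.Perm (Fin (∑ i, m i)))
    (f : (Fin (∑ i, m i) → Fin n) → ℝ) :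
    ∑ d ∈ decks m, f (d ∘ e) = ∑ d ∈ decks m, f d := by
  refine Finset.sum_equiv (Equiv.arrowCongr e.symm (Equiv.refl _)) (fun d => ?_) (fun d _ => rfl)
  simp only [decks, Finset.mem_filter, Finset.mem_univ, true_and]
  refine forall_congr' fun i => ?_
  rw [← Finset.card_map e.toEmbedding (s := Finset.univ.filter fun t =>
    (Equiv.arrowCongr e.symm (Equiv.refl _)) d t = i)]
  congr! 2
  ext t
  simp only [Finset.mem_filter, Finset.mem_univ, true_and, Finset.mem_map_equiv]
  simp [Equiv.arrowCongr]

theorem take_ofFn_comp_swap {n N : ℕ} (d : Fin N → Fin n) {t s : Fin N} (h : t ≤ s) :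
    (List.ofFn (d ∘ Equiv.swap t s)).take t = (List.ofFn d).take t := by
  refine List.ext_getElem (by simp) fun k h₁ h₂ => ?_
  simp only [List.length_take, List.length_ofFn, lt_min_iff] at h₁
  simp only [List.getElem_take, List.getElem_ofFn, Function.comp]
  rw [Equiv.swap_apply_of_ne_of_ne]
  · exact fun h' => by simp [← h'] at h₁
  · intro h'
    have := Fin.le_def.1 h
    rw [← h'] at this
    simp only at this
    omega

theorem hits_eq_sum {n N : ℕ} (d : Fin N → Fin n) (S : Finset (Fin N)) (i : Fin n) :
    (hits d S i : ℝ) = ∑ s ∈ S, if i = d s then (1 : ℝ) else 0 := by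
  simp [hits, eq_comm]

/-- Swapping `t` with a later position `s` permutes the decks and keeps the first `t` cards, hence
the guess. So the card at `t` may be replaced by the average over all unseen positions. -/
theorem sum_correct_eq {n : ℕ} (m : Fin n → ℕ) (σ : Strategy n) (t : Fin (∑ i, m i)) :
    ∑ d ∈ decks m, (if σ ((List.ofFn d).take t) = d t then (1 : ℝ) else 0) =
      (∑ d ∈ decks m, (hits d (Finset.Ici t) (σ ((List.ofFn d).take t)) : ℝ)) /
        ((Finset.Ici t).card : ℝ) := by
  have hpos : ((Finset.Ici t).card : ℝ) ≠ 0 := by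
    simp only [ne_eq, Nat.cast_eq_zero, Finset.card_eq_zero]
    exact Finset.Nonempty.ne_empty ⟨t, by simp⟩
  rw [eq_div_iff hpos]
  simp_rw [hits_eq_sum]
  rw [Finset.sum_comm, mul_comm, ← nsmul_eq_mul]
  symm
  refine Finset.sum_eq_card_nsmul fun s hs => ?_
  rw [← sum_decks_comp m (Equiv.swap t s)]
  refine Finset.sum_congr rfl fun d _ => ?_
  rw [take_ofFn_comp_swap d (Finset.mem_Ici.1 hs)]
  simp

theorem expectedCorrect_eq {n : ℕ} (m : Fin n → ℕ) (σ : Strategy n) :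
    expectedCorrect m σ = (∑ t : Fin (∑ i, m i), (∑ d ∈ decks m,
      (hits d (Finset.Ici t) (σ ((List.ofFn d).take t)) : ℝ)) / ((Finset.Ici t).card : ℝ)) /
        ((decks m).card : ℝ) := by
  rw [expectedCorrect]
  congr 1
  simp_rw [← sum_correct_eq]
  rw [Finset.sum_comm]
  refine Finset.sum_congr rfl fun d _ => ?_
  simp [correctGuesses]

theorem count_take_add_hits {n N : ℕ} (d : Fin N → Fin n) (i : Fin n) (k : ℕ) (hk : k ≤ N) :
    ((List.ofFn d).take k).count i + hits d (Finset.univ.filter fun s => k ≤ s.val) i =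
      hits d Finset.univ i := by
  induction k with
  | zero => simp
  | succ k ih =>
    rw [← ih (by omega), List.take_add_one, List.count_append, add_assoc]
    congr 1
    have hk' : k < N := hk
    rw [List.getElem?_ofFn, dif_pos hk']
    have h : (Finset.univ.filter fun s : Fin N => k ≤ s.val) =
        insert ⟨k, hk'⟩ (Finset.univ.filter fun s : Fin N => k + 1 ≤ s.val) := by
      ext s
      simp only [Finset.mem_filter, Finset.mem_univ, true_and, Finset.mem_insert, Fin.ext_iff]
      omega
    rw [h, hits, hits, Finset.filter_insert]
    by_cases hd : d ⟨k, hk'⟩ = i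
    · simp [hd, Finset.card_insert_of_notMem, add_comm]
    · simp [hd]

theorem count_take_add_hits_Ici {n : ℕ} {m : Fin n → ℕ} {d : Fin (∑ i, m i) → Fin n}
    (hd : d ∈ decks m) (t : Fin (∑ i, m i)) (i : Fin n) :
    ((List.ofFn d).take t).count i + hits d (Finset.Ici t) i = m i := by
  have h := count_take_add_hits d i t.val t.isLt.le
  have h' : (Finset.univ.filter fun s : Fin (∑ i, m i) => t.val ≤ s.val) = Finset.Ici t := by
    ext s
    simp only [Finset.mem_filter, Finset.mem_univ, true_and, Finset.mem_Ici, Fin.le_def]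
  rw [h'] at h
  rw [h]
  exact (Finset.mem_filter.1 hd).2 i

/-- The expected number of correct guesses of a greedy strategy. -/
noncomputable def greedyValue {n : ℕ} (m : Fin n → ℕ) : ℝ :=
  (∑ t : Fin (∑ i, m i), (∑ d ∈ decks m,
    ((Finset.univ.sup (hits d (Finset.Ici t)) : ℕ) : ℝ)) / ((Finset.Ici t).card : ℝ)) /
      ((decks m).card : ℝ)

theorem expectedCorrect_le {n : ℕ} (m : Fin n → ℕ) (σ : Strategy n) :
    expectedCorrect m σ ≤ greedyValue m := by
  rw [expectedCorrect_eq, greedyValue]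
  gcongr with t _ d _
  exact Finset.le_sup (f := hits d (Finset.Ici t)) (Finset.mem_univ _)

theorem IsGreedy.expectedCorrect_eq {n : ℕ} {m : Fin n → ℕ} {σ : Strategy n}
    (hσ : IsGreedy m σ) : expectedCorrect m σ = greedyValue m := by
  rw [CardGuess.expectedCorrect_eq, greedyValue]
  congr! 5 with t _ d hd
  refine le_antisymm (Finset.le_sup (f := hits d (Finset.Ici t)) (Finset.mem_univ _))
    (Finset.sup_le fun i _ => ?_)
  have hc := count_take_add_hits_Ici hd t
  have h := hσ ((List.ofFn d).take t) (fun i => by have := hc i; omega) i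
  have h₁ := hc i
  have h₂ := hc (σ ((List.ofFn d).take t))
  omega

theorem IsGreedy.isBest {n : ℕ} {m : Fin n → ℕ} {σ : Strategy n} (hσ : IsGreedy m σ) :
    IsBest m σ := fun τ => by
  rw [hσ.expectedCorrect_eq]
  exact expectedCorrect_le m τ

theorem IsBest.expectedCorrect_eq {n : ℕ} (hn : 1 ≤ n) {m : Fin n → ℕ} {σ : Strategy n}
    (hσ : IsBest m σ) : expectedCorrect m σ = greedyValue m := by
  obtain ⟨τ, hτ⟩ := exists_isGreedy hn m
  exact le_antisymm (expectedCorrect_le m σ) (hτ.expectedCorrect_eq ▸ hσ τ)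

/-! ### Independent sampling of positions -/

/-- The probability that a binomial random variable with parameters `m` and `p` is below `j`. -/
noncomputable def binomBelow (m j : ℕ) (p : ℝ) : ℝ :=
  ∑ l ∈ Finset.range (m + 1), (m.choose l : ℝ) * if l < j then p ^ l * (1 - p) ^ (m - l) else 0

/-- A set of positions amounts to an independent choice, for each type, of a subset of the positions
of that type. -/
theorem sum_subsets_prod {n N : ℕ} (d : Fin N → Fin n) (f : Fin n → Finset (Fin N) → ℝ) :
    ∑ S : Finset (Fin N), ∏ i, f i (S.filter fun s => d s = i) =
      ∏ i, ∑ S ∈ (Finset.univ.filter fun s => d s = i).powerset, f i S := by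
  rw [Finset.prod_univ_sum]
  refine Finset.sum_bij' (fun S _ i => S.filter fun s => d s = i)
    (fun x _ => Finset.univ.biUnion x) ?_ ?_ ?_ ?_ ?_
  · intro S _
    simp only [Fintype.mem_piFinset, Finset.mem_powerset]
    exact fun i => Finset.filter_subset_filter _ (Finset.subset_univ _)
  · simp
  · intro S _
    ext s
    simp
  · intro x hx
    simp only [Fintype.mem_piFinset, Finset.mem_powerset, Finset.subset_iff, Finset.mem_filter,
      Finset.mem_univ, true_and] at hx
    ext i s
    simp only [Finset.mem_filter, Finset.mem_biUnion, Finset.mem_univ, true_and]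
    constructor
    · rintro ⟨⟨k, hk⟩, rfl⟩
      rwa [← hx k hk] at hk
    · exact fun h => ⟨⟨i, h⟩, hx i h⟩
  · intro S _
    rfl

theorem sum_subsets_hits_lt {n : ℕ} {m : Fin n → ℕ} {d : Fin (∑ i, m i) → Fin n}
    (hd : d ∈ decks m) (j : ℕ) (p : ℝ) :
    ∑ S : Finset (Fin (∑ i, m i)), (p ^ S.card * (1 - p) ^ ((∑ i, m i) - S.card)) *
      (if ∀ i, hits d S i < j then (1 : ℝ) else 0) = ∏ i, binomBelow (m i) j p := by
  have hm := (Finset.mem_filter.1 hd).2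
  have key := sum_subsets_prod d fun i S =>
    if S.card < j then p ^ S.card * (1 - p) ^ (m i - S.card) else 0
  convert key using 2 with S _ i _
  · have hle : ∀ i, hits d S i ≤ m i := fun i => by
      rw [← hm i]
      exact Finset.card_le_card (Finset.filter_subset_filter _ (Finset.subset_univ _))
    have hsum : S.card = ∑ i, hits d S i :=
      Finset.card_eq_sum_card_fiberwise fun s _ => Finset.mem_coe.2 (Finset.mem_univ (d s))
    change _ = ∏ i, if hits d S i < j then p ^ hits d S i * (1 - p) ^ (m i - hits d S i) else 0
    split_ifs with h
    · rw [Finset.prod_congr rfl fun i _ => if_pos (h i), Finset.prod_mul_distrib,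
        Finset.prod_pow_eq_pow_sum, Finset.prod_pow_eq_pow_sum, hsum, mul_one,
        Finset.sum_tsub_distrib _ fun i _ => hle i]
    · obtain ⟨i, hi⟩ := not_forall.1 h
      rw [mul_zero, Finset.prod_eq_zero (Finset.mem_univ i) (if_neg hi)]
  · rw [Finset.sum_powerset_apply_card fun k => if k < j then p ^ k * (1 - p) ^ (m i - k) else 0,
      hm i]
    simp [binomBelow]

theorem sum_subsets_weight (N : ℕ) (p : ℝ) :
    ∑ S : Finset (Fin N), p ^ S.card * (1 - p) ^ (N - S.card) = 1 := by
  have := Finset.sum_powerset_apply_card (fun k => p ^ k * (1 - p) ^ (N - k))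
    (x := (Finset.univ : Finset (Fin N)))
  rw [Finset.powerset_univ] at this
  rw [this, Finset.card_univ, Fintype.card_fin]
  have h := add_pow p (1 - p) N
  rw [add_sub_cancel, one_pow] at h
  refine Eq.trans (Finset.sum_congr rfl fun k _ => ?_) h.symm
  rw [nsmul_eq_mul, mul_comm]

/-- The number of decks that have at least `j` cards of some type in the positions `S`. -/
noncomputable def reachCount {n : ℕ} (m : Fin n → ℕ) (j : ℕ) (S : Finset (Fin (∑ i, m i))) : ℝ :=
  ∑ d ∈ decks m, if ∀ i, hits d S i < j then (0 : ℝ) else 1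

/-- A permutation of positions carrying `S` to `T` preserves the set of decks; this lets the
probability depend on the size of `S` only. -/
theorem reachCount_congr {n : ℕ} (m : Fin n → ℕ) (j : ℕ) {S T : Finset (Fin (∑ i, m i))}
    (h : S.card = T.card) : reachCount m j S = reachCount m j T := by
  obtain ⟨e, he⟩ : ∃ e : Equiv.Perm (Fin (∑ i, m i)), S.map e.toEmbedding = T := by
    classical
    let e₀ : {x // x ∈ S} ≃ {x // x ∈ T} := Finset.equivOfCardEq h
    refine ⟨e₀.extendSubtype, Finset.eq_of_subset_of_card_le ?_ (by simp [h])⟩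
    intro x hx
    obtain ⟨s, hs, rfl⟩ := Finset.mem_map.1 hx
    exact e₀.extendSubtype_mem s hs
  rw [reachCount, reachCount, ← sum_decks_comp m e]
  refine Finset.sum_congr rfl fun d _ => ?_
  have : ∀ i, hits (d ∘ e) S i = hits d T i := fun i => by
    rw [hits, hits, ← he, Finset.filter_map, Finset.card_map]
    rfl
  simp_rw [this]

theorem sum_subsets_reachCount {n : ℕ} (m : Fin n → ℕ) (j : ℕ) (p : ℝ) :
    ∑ S : Finset (Fin (∑ i, m i)), (p ^ S.card * (1 - p) ^ ((∑ i, m i) - S.card)) *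
      reachCount m j S = ((decks m).card : ℝ) * (1 - ∏ i, binomBelow (m i) j p) := by
  simp_rw [reachCount, Finset.mul_sum]
  rw [Finset.sum_comm, ← nsmul_eq_mul]
  refine Finset.sum_eq_card_nsmul fun d hd => ?_
  rw [← sum_subsets_hits_lt hd]
  refine Eq.trans ?_ (congrArg (· - _) (sum_subsets_weight (∑ i, m i) p))
  rw [← Finset.sum_sub_distrib]
  refine Finset.sum_congr rfl fun S _ => ?_
  split_ifs <;> simp

theorem natCast_sup_eq_sum {n : ℕ} (f : Fin n → ℕ) {M : ℕ} (hM : ∀ i, f i ≤ M) :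
    ((Finset.univ.sup f : ℕ) : ℝ) =
      ∑ j ∈ Finset.Icc 1 M, if ∀ i, f i < j then (0 : ℝ) else 1 := by
  have h : ∀ j ∈ Finset.Icc 1 M, (if ∀ i, f i < j then (0 : ℝ) else 1) =
      if j ∈ Finset.Icc 1 (Finset.univ.sup f) then 1 else 0 := fun j hj => by
    have hj1 := (Finset.mem_Icc.1 hj).1
    have h1 : (∀ i, f i < j) ↔ Finset.univ.sup f < j := by
      rw [Finset.sup_lt_iff hj1]
      simp
    simp only [h1, Finset.mem_Icc, hj1, true_and]
    by_cases hlt : Finset.univ.sup f < j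
    · simp [hlt]
    · simp [hlt, not_lt.1 hlt]
  rw [Finset.sum_congr rfl h, ← Finset.sum_filter, Finset.filter_mem_eq_inter,
    Finset.inter_eq_right.2 (Finset.Icc_subset_Icc_right (Finset.sup_le fun i _ => hM i))]
  simp

/-- `q j k` is the probability that `k` positions contain at least `j` cards of one type. The second
property is its average over a binomial `k`. -/
theorem exists_reach_probability {n : ℕ} (m : Fin n → ℕ) {M : ℕ} (hM : ∀ i, m i ≤ M) :
    ∃ q : ℕ → ℕ → ℝ, (∀ j, 1 ≤ j → q j 0 = 0) ∧
      (∀ j p, ∑ k ∈ Finset.range ((∑ i, m i) + 1), ((∑ i, m i).choose k : ℝ) *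
        (p ^ k * (1 - p) ^ ((∑ i, m i) - k) * q j k) = 1 - ∏ i, binomBelow (m i) j p) ∧
      greedyValue m = ∑ j ∈ Finset.Icc 1 M, ∑ k ∈ Finset.range (∑ i, m i),
        q j (k + 1) / ((k : ℝ) + 1) := by
  have hD : ((decks m).card : ℝ) ≠ 0 := by
    simpa using (decks_nonempty m).ne_empty
  have hf : ∀ j, Function.FactorsThrough (fun S => reachCount m j S / ((decks m).card : ℝ))
      Finset.card := fun j S T h => by
    simp only [reachCount_congr m j h]
  choose q hq using fun j => (Function.factorsThrough_iff _).1 (hf j)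
  have hq' : ∀ j S, reachCount m j S / ((decks m).card : ℝ) = q j S.card :=
    fun j S => congrFun (hq j) S
  refine ⟨q, fun j hj => ?_, fun j p => ?_, ?_⟩
  · rw [← Finset.card_empty (α := Fin (∑ i, m i)), ← hq']
    have : ∀ d : Fin (∑ i, m i) → Fin n, ∀ i, hits d ∅ i < j := fun d i => by
      simpa [hits] using Nat.lt_of_succ_le hj
    simp [reachCount, this]
  · have h := Finset.sum_powerset_apply_card
      (fun k => p ^ k * (1 - p) ^ ((∑ i, m i) - k) * q j k)
      (x := (Finset.univ : Finset (Fin (∑ i, m i))))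
    rw [Finset.powerset_univ, Finset.card_univ, Fintype.card_fin] at h
    simp_rw [← hq', nsmul_eq_mul] at h
    rw [← h]
    simp_rw [← mul_div_assoc]
    rw [← Finset.sum_div, sum_subsets_reachCount, mul_div_cancel_left₀ _ hD]
  · have h1 : greedyValue m = ∑ t : Fin (∑ i, m i), ∑ j ∈ Finset.Icc 1 M,
        q j ((∑ i, m i) - t) / (((∑ i, m i) - t : ℕ) : ℝ) := by
      rw [greedyValue, Finset.sum_div]
      refine Finset.sum_congr rfl fun t _ => ?_
      rw [← Finset.sum_div, div_right_comm]
      have hcard : (Finset.Ici t).card = (∑ i, m i) - t := by simp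
      rw [hcard]
      congr 1
      simp_rw [← hcard, ← hq', ← Finset.sum_div, reachCount]
      congr 1
      rw [Finset.sum_comm]
      refine Finset.sum_congr rfl fun d hd => natCast_sup_eq_sum _ fun i => ?_
      have := count_take_add_hits_Ici hd t i
      have := hM i
      omega
    rw [h1, Finset.sum_comm]
    refine Finset.sum_congr rfl fun j _ => ?_
    -- Reindex by the number of remaining cards, `k + 1 = N - t`.
    rw [Fin.sum_univ_eq_sum_range
      (fun t => q j ((∑ i, m i) - t) / (((∑ i, m i) - t : ℕ) : ℝ)), ← Finset.sum_range_reflect]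
    refine Finset.sum_congr rfl fun k hk => ?_
    have hk := Finset.mem_range.1 hk
    have : (∑ i, m i) - ((∑ i, m i) - 1 - k) = k + 1 := by omega
    rw [this]
    push_cast
    rfl

/-! ### Estimates for binomial probabilities and their products -/

theorem binomBelow_eq_one {m j : ℕ} (h : m < j) (p : ℝ) : binomBelow m j p = 1 := by
  have h' := add_pow p (1 - p) m
  rw [add_sub_cancel, one_pow] at h'
  rw [h', binomBelow]
  refine Finset.sum_congr rfl fun l hl => ?_
  rw [if_pos (by have := Finset.mem_range.1 hl; omega)]
  ring

theorem binomBelow_nonneg (m j : ℕ) {p : ℝ} (h0 : 0 ≤ p) (h1 : p ≤ 1) : 0 ≤ binomBelow m j p := by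
  have := sub_nonneg.2 h1
  refine Finset.sum_nonneg fun l _ => ?_
  split_ifs <;> positivity

theorem one_sub_binomBelow {m j : ℕ} (h : j ≤ m) (p : ℝ) :
    1 - binomBelow m j p = p ^ j * ∑ l ∈ Finset.range (m - j + 1),
      (m.choose (j + l) : ℝ) * (p ^ l * (1 - p) ^ (m - j - l)) := by
  have h1 := add_pow p (1 - p) m
  rw [add_sub_cancel, one_pow] at h1
  have hr : m + 1 = j + (m - j + 1) := by omega
  nth_rw 1 [h1]
  rw [binomBelow, ← Finset.sum_sub_distrib, hr, Finset.sum_range_add, Finset.mul_sum,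
    Finset.sum_eq_zero, zero_add]
  · refine Finset.sum_congr rfl fun l _ => ?_
    rw [if_neg (by omega), Nat.sub_add_eq, pow_add]
    ring
  · intro l hl
    rw [if_pos (Finset.mem_range.1 hl)]
    ring

/-- After `p ^ j` is factored out of the tail, the cofactor dominates the expansion of `(p + (1 -
p)) ^ (m - j) = 1` term by term. -/
theorem binomBelow_le {m j : ℕ} (h : j ≤ m) {p : ℝ} (h0 : 0 ≤ p) (h1 : p ≤ 1) :
    binomBelow m j p ≤ 1 - p ^ j := by
  have hq := sub_nonneg.2 h1
  have h2 : p ^ j * 1 ≤ 1 - binomBelow m j p := by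
    rw [one_sub_binomBelow h]
    have h' := add_pow p (1 - p) (m - j)
    rw [add_sub_cancel, one_pow] at h'
    refine mul_le_mul_of_nonneg_left (h'.le.trans (Finset.sum_le_sum fun l hl => ?_)) (by positivity)
    rw [mul_comm]
    gcongr
    have hl := Finset.mem_range.1 hl
    calc (m - j).choose l = (m - j).choose (m - j - l) := (Nat.choose_symm (by omega)).symm
      _ ≤ m.choose (m - j - l) := Nat.choose_le_choose _ (by omega)
      _ = m.choose (j + l) := by
        rw [← Nat.choose_symm (by omega)]
        congr 1
        omega
  linarith

theorem abs_binomBelow_sub_le {m j : ℕ} (h : j ≤ m) {p : ℝ} (h0 : 0 ≤ p) (h1 : p ≤ 1) :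
    |binomBelow m j p - (1 - (m.choose j : ℝ) * p ^ j)| ≤ 2 * m * 2 ^ m * p ^ (j + 1) := by
  have hq := sub_nonneg.2 h1
  have hq1 : 1 - p ≤ 1 := by linarith
  have hch : ∀ l, (m.choose l : ℝ) ≤ 2 ^ m := fun l => by exact_mod_cast Nat.choose_le_two_pow m l
  have h2 := one_sub_binomBelow h p
  rw [Finset.sum_range_succ'] at h2
  set T := ∑ k ∈ Finset.range (m - j), (m.choose (j + (k + 1)) : ℝ) *
    (p ^ (k + 1) * (1 - p) ^ (m - j - (k + 1))) with hT
  have hT0 : 0 ≤ T := Finset.sum_nonneg fun k _ => by positivity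
  have hT1 : T ≤ m * 2 ^ m * p := by
    have : T ≤ (Finset.range (m - j)).card • (2 ^ m * p) := by
      refine Finset.sum_le_card_nsmul _ _ _ fun k _ => ?_
      calc _ ≤ (2 : ℝ) ^ m * (p ^ (k + 1) * 1) := by
            gcongr
            · exact hch _
            · exact pow_le_one₀ hq hq1
        _ ≤ 2 ^ m * p := by
            rw [mul_one]
            gcongr
            exact pow_le_of_le_one h0 h1 (by omega)
    rw [Finset.card_range, nsmul_eq_mul] at this
    refine this.trans ?_
    rw [mul_assoc]
    gcongr
    omega
  have hB := one_add_mul_le_pow (a := -p) (by linarith) (m - j)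
  rw [← sub_eq_add_neg] at hB
  have hB1 : (1 - p) ^ (m - j) ≤ 1 := pow_le_one₀ hq hq1
  have hmj : ((m - j : ℕ) : ℝ) * p ≤ m * p := by
    gcongr
    omega
  have hc := hch j
  have hc0 : (0 : ℝ) ≤ m.choose j := by positivity
  have heq : binomBelow m j p - (1 - (m.choose j : ℝ) * p ^ j) =
      p ^ j * ((m.choose j : ℝ) * (1 - (1 - p) ^ (m - j)) - T) := by
    simp only [add_zero, pow_zero, one_mul, Nat.sub_zero] at h2
    linear_combination -h2
  have hpj : 0 ≤ p ^ j := by positivity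
  rw [heq, abs_mul, abs_of_nonneg hpj, pow_succ]
  have h3 : (m.choose j : ℝ) * (1 - (1 - p) ^ (m - j)) ≤ 2 ^ m * (m * p) :=
    mul_le_mul hc (by linarith) (by linarith) (by positivity)
  have h4 : 0 ≤ (m.choose j : ℝ) * (1 - (1 - p) ^ (m - j)) :=
    mul_nonneg hc0 (by linarith)
  have h5 : |(m.choose j : ℝ) * (1 - (1 - p) ^ (m - j)) - T| ≤ 2 * m * 2 ^ m * p := by
    rw [abs_le]
    constructor <;> nlinarith
  nlinarith [mul_le_mul_of_nonneg_left h5 hpj]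

theorem abs_one_sub_pow_sub_le {q : ℝ} (h0 : 0 ≤ q) (h1 : q ≤ 1) (c : ℕ) :
    |(1 - q) ^ c - (1 - c * q)| ≤ c ^ 2 * q ^ 2 := by
  have hB := one_add_mul_le_pow (a := -q) (by linarith) c
  rw [← sub_eq_add_neg] at hB
  have hU : (1 - q) ^ c ≤ 1 - c * q + c ^ 2 * q ^ 2 := by
    clear hB
    induction c with
    | zero => simp
    | succ c ih =>
      have h := mul_le_mul_of_nonneg_right ih (sub_nonneg.2 h1)
      rw [pow_succ]
      push_cast
      have : (0 : ℝ) ≤ c := by positivity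
      have h3 : 0 ≤ (c : ℝ) ^ 2 * q ^ 2 * q := by positivity
      have h4 : 0 ≤ (c : ℝ) * q ^ 2 := by positivity
      nlinarith
  rw [abs_le]
  have : (0 : ℝ) ≤ c ^ 2 * q ^ 2 := by positivity
  constructor <;> linarith

/-- Both quantities are `1 - C(m,j) p^j` up to `O(p^(j+1))`. The power form is chosen because its
product over the types is a single power of `1 - p^j`. -/
theorem abs_binomBelow_sub_pow_le {M m j : ℕ} (hj : 1 ≤ j) (h : j ≤ m) (hm : m ≤ M) {p : ℝ}
    (h0 : 0 ≤ p) (h1 : p ≤ 1) :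
    |binomBelow m j p - (1 - p ^ j) ^ m.choose j| ≤
      (2 * M * 2 ^ M + (2 ^ M) ^ 2) * p ^ (j + 1) := by
  have ha := abs_binomBelow_sub_le h h0 h1
  have hb := abs_one_sub_pow_sub_le (pow_nonneg h0 j) (pow_le_one₀ h0 h1 (n := j)) (m.choose j)
  have hch : (m.choose j : ℝ) ≤ 2 ^ M := by
    exact_mod_cast (Nat.choose_le_two_pow m j).trans (Nat.pow_le_pow_right (by norm_num) hm)
  have hp : (p ^ j) ^ 2 ≤ p ^ (j + 1) := by
    rw [← pow_mul]
    exact pow_le_pow_of_le_one h0 h1 (by omega)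
  have ha' : 2 * (m : ℝ) * 2 ^ m * p ^ (j + 1) ≤ 2 * M * 2 ^ M * p ^ (j + 1) := by
    gcongr
    norm_num
  have hb' : (m.choose j : ℝ) ^ 2 * (p ^ j) ^ 2 ≤ (2 ^ M) ^ 2 * p ^ (j + 1) := by
    gcongr
  have := abs_sub_le (binomBelow m j p) (1 - (m.choose j : ℝ) * p ^ j)
    ((1 - p ^ j) ^ m.choose j)
  rw [abs_sub_comm (1 - (m.choose j : ℝ) * p ^ j)] at this
  linarith

/-- Telescoping: exchange one factor at a time, the others contributing at most `x` each. -/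
theorem abs_prod_sub_prod_le {ι : Type*} (s : Finset ι) (a b : ι → ℝ) {x e : ℝ}
    (ha0 : ∀ i ∈ s, 0 ≤ a i) (ha : ∀ i ∈ s, a i ≤ x) (hb0 : ∀ i ∈ s, 0 ≤ b i)
    (hb : ∀ i ∈ s, b i ≤ x) (he : ∀ i ∈ s, |a i - b i| ≤ e) :
    |∏ i ∈ s, a i - ∏ i ∈ s, b i| ≤ s.card * (e * x ^ (s.card - 1)) := by
  classical
  induction s using Finset.induction_on with
  | empty => simp
  | insert k s hk ih =>
    simp only [Finset.forall_mem_insert] at ha0 ha hb0 hb he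
    have ih := ih ha0.2 ha.2 hb0.2 hb.2 he.2
    have hx : 0 ≤ x := ha0.1.trans ha.1
    have he0 : 0 ≤ e := (abs_nonneg _).trans he.1
    have hP0 : 0 ≤ ∏ i ∈ s, a i := Finset.prod_nonneg ha0.2
    have hP : ∏ i ∈ s, a i ≤ x ^ s.card := by
      simpa using Finset.prod_le_prod ha0.2 ha.2
    rw [Finset.prod_insert hk, Finset.prod_insert hk, Finset.card_insert_of_notMem hk,
      Nat.add_sub_cancel]
    have heq : a k * ∏ i ∈ s, a i - b k * ∏ i ∈ s, b i =
        (a k - b k) * ∏ i ∈ s, a i + b k * (∏ i ∈ s, a i - ∏ i ∈ s, b i) := by ring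
    have h1 : |(a k - b k) * ∏ i ∈ s, a i| ≤ e * x ^ s.card := by
      rw [abs_mul, abs_of_nonneg hP0]
      exact mul_le_mul he.1 hP hP0 he0
    have h2 : |b k * (∏ i ∈ s, a i - ∏ i ∈ s, b i)| ≤ s.card * (e * x ^ s.card) := by
      rw [abs_mul, abs_of_nonneg hb0.1]
      refine (mul_le_mul hb.1 ih (abs_nonneg _) hx).trans (le_of_eq ?_)
      rcases Nat.eq_zero_or_pos s.card with h | h
      · simp [h]
      · obtain ⟨c, hc⟩ := Nat.exists_eq_add_of_lt h
        rw [hc, zero_add, Nat.add_sub_cancel, pow_succ]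
        ring
    rw [heq]
    refine (abs_add_le _ _).trans ?_
    push_cast
    linarith

/-! ### Integrals over the unit interval -/

theorem integral_pow_mul_one_sub_pow_pow {j : ℕ} (hj : 1 ≤ j) (s : ℕ) :
    ∫ p in (0 : ℝ)..1, p ^ (j - 1) * (1 - p ^ j) ^ s = 1 / (j * (s + 1)) := by
  have hj0 : (j : ℝ) ≠ 0 := by positivity
  have hs0 : (s : ℝ) + 1 ≠ 0 := by positivity
  have hd : ∀ p ∈ Set.uIcc (0 : ℝ) 1, HasDerivAt
      (fun p : ℝ => -(1 - p ^ j) ^ (s + 1) / (j * (s + 1))) (p ^ (j - 1) * (1 - p ^ j) ^ s) p := by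
    intro p _
    have h := ((((hasDerivAt_pow j p).const_sub 1).pow (s + 1)).neg).div_const ((j : ℝ) * (s + 1))
    refine HasDerivAt.congr_deriv h ?_
    push_cast
    field_simp
  rw [intervalIntegral.integral_eq_sub_of_hasDerivAt hd
    ((by fun_prop : Continuous _).intervalIntegrable _ _)]
  simp only [one_pow, sub_self, zero_pow (by omega : j ≠ 0), zero_pow (Nat.succ_ne_zero s), sub_zero]
  ring

theorem integral_pow_mul_one_sub_pow_pow' {j K : ℕ} (hj : 1 ≤ j) (hK : 1 ≤ K) :
    ∫ p in (0 : ℝ)..1, p ^ (2 * j - 1) * (1 - p ^ j) ^ (K - 1) = 1 / (j * K * (K + 1)) := by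
  have hj0 : (j : ℝ) ≠ 0 := by positivity
  have hK0 : (K : ℝ) ≠ 0 := by positivity
  have hK1 : (K : ℝ) + 1 ≠ 0 := by positivity
  have h : ∀ p : ℝ, p ^ (2 * j - 1) * (1 - p ^ j) ^ (K - 1) =
      p ^ (j - 1) * (1 - p ^ j) ^ (K - 1) - p ^ (j - 1) * (1 - p ^ j) ^ K := fun p => by
    obtain ⟨k, rfl⟩ := Nat.exists_eq_add_of_le' hK
    have : 2 * j - 1 = (j - 1) + j := by omega
    rw [this, pow_add, Nat.add_sub_cancel, pow_succ]
    ring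
  simp_rw [h]
  rw [intervalIntegral.integral_sub ((by fun_prop : Continuous _).intervalIntegrable _ _)
    ((by fun_prop : Continuous _).intervalIntegrable _ _), integral_pow_mul_one_sub_pow_pow hj,
    integral_pow_mul_one_sub_pow_pow hj]
  rw [Nat.cast_sub hK]
  push_cast
  rw [sub_add_cancel]
  field_simp
  ring

theorem integral_pow_mul_one_sub_pow_le {j K : ℕ} (hj : 1 ≤ j) (hK : 1 ≤ K) :
    ∫ p in (0 : ℝ)..1, p ^ j * (1 - p ^ j) ^ (K - 1) ≤
      2 / K * (1 / (K : ℝ)) ^ (1 / (j : ℝ)) := by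
  have hj0 : (0 : ℝ) < j := by positivity
  have hj1 : (1 : ℝ) ≤ j := by exact_mod_cast hj
  have hK0 : (0 : ℝ) < K := by positivity
  set δ : ℝ := (1 / (K : ℝ)) ^ (1 / (j : ℝ)) with hδ
  have hδ0 : 0 < δ := by positivity
  have hδj : δ ^ j = 1 / K := by
    rw [hδ, ← Real.rpow_natCast, ← Real.rpow_mul (by positivity), one_div_mul_cancel hj0.ne',
      Real.rpow_one]
  -- `δ = K^(-1/j)` is the scale where `K p^j = 1`. This bound trades the surplus factor `p` for `δ`
  -- plus a multiple of `p ^ j`, leaving two integrals known exactly.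
  have hp : ∀ p : ℝ, 0 ≤ p → p ≤ δ + δ * K * p ^ j := fun p hp => by
    rcases le_total p δ with h | h
    · have : 0 ≤ δ * K * p ^ j := by positivity
      linarith
    · obtain ⟨k, rfl⟩ := Nat.exists_eq_add_of_le' hj
      have h1 : δ ^ k * p ≤ p ^ (k + 1) := by
        rw [pow_succ]
        gcongr
      have h2 : δ * K * δ ^ k = 1 := by
        rw [pow_succ] at hδj
        field_simp at hδj
        linarith
      have : δ * K * (δ ^ k * p) ≤ δ * K * p ^ (k + 1) := by gcongr
      have h3 : δ * K * (δ ^ k * p) = p := by rw [← mul_assoc, h2, one_mul]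
      linarith
  have hmono : ∫ p in (0 : ℝ)..1, p ^ j * (1 - p ^ j) ^ (K - 1) ≤
      ∫ p in (0 : ℝ)..1, (δ * (p ^ (j - 1) * (1 - p ^ j) ^ (K - 1)) +
        δ * K * (p ^ (2 * j - 1) * (1 - p ^ j) ^ (K - 1))) := by
    refine intervalIntegral.integral_mono_on zero_le_one
      ((by fun_prop : Continuous _).intervalIntegrable _ _)
      ((by fun_prop : Continuous _).intervalIntegrable _ _) fun p h => ?_
    have h1 : 0 ≤ 1 - p ^ j := sub_nonneg.2 (pow_le_one₀ h.1 h.2)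
    have h2 : p ^ j = p ^ (j - 1) * p := by rw [← pow_succ, Nat.sub_add_cancel hj]
    have h3 : p ^ (2 * j - 1) = p ^ (j - 1) * p ^ j := by
      rw [← pow_add]
      congr 1
      omega
    have h4 : 0 ≤ p ^ (j - 1) * (1 - p ^ j) ^ (K - 1) :=
      mul_nonneg (pow_nonneg h.1 _) (pow_nonneg h1 _)
    calc p ^ j * (1 - p ^ j) ^ (K - 1) = (p ^ (j - 1) * (1 - p ^ j) ^ (K - 1)) * p := by
          nth_rw 1 [h2]
          ring
      _ ≤ (p ^ (j - 1) * (1 - p ^ j) ^ (K - 1)) * (δ + δ * K * p ^ j) := by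
          gcongr
          exact hp p h.1
      _ = _ := by
          rw [h3]
          ring
  refine hmono.trans ?_
  rw [intervalIntegral.integral_add ((by fun_prop : Continuous _).intervalIntegrable _ _)
    ((by fun_prop : Continuous _).intervalIntegrable _ _), intervalIntegral.integral_const_mul,
    intervalIntegral.integral_const_mul, integral_pow_mul_one_sub_pow_pow hj,
    integral_pow_mul_one_sub_pow_pow' hj hK, Nat.cast_sub hK, Nat.cast_one, sub_add_cancel]
  have e1 : δ * (1 / (j * K)) ≤ δ / K := by
    rw [mul_one_div]
    gcongr
    nlinarith
  have e2 : δ * K * (1 / (j * K * (K + 1))) ≤ δ / K := by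
    have : δ * K * (1 / (j * K * (K + 1))) = δ / (j * (K + 1)) := by field_simp
    rw [this]
    gcongr
    nlinarith
  calc _ ≤ δ / K + δ / K := add_le_add e1 e2
    _ = _ := by ring

/-- A Beta integral, by induction through integration by parts; it produces the weights `1 / (k +
1)`. -/
theorem integral_pow_mul_one_sub_pow_choose (k l : ℕ) :
    ((k + l + 1).choose (k + 1) : ℝ) * ∫ p in (0 : ℝ)..1, p ^ k * (1 - p) ^ l = 1 / (k + 1) := by
  induction l generalizing k with
  | zero => simp
  | succ l ih =>
    have hd : ∀ p ∈ Set.uIcc (0 : ℝ) 1, HasDerivAt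
        (fun p : ℝ => p ^ (k + 1) * (1 - p) ^ (l + 1))
        ((k + 1) * (p ^ k * (1 - p) ^ (l + 1)) - (l + 1) * (p ^ (k + 1) * (1 - p) ^ l)) p := by
      intro p _
      have h := (hasDerivAt_pow (k + 1) p).mul (((hasDerivAt_id p).const_sub 1).pow (l + 1))
      refine HasDerivAt.congr_deriv h ?_
      simp only [Pi.pow_apply, Nat.add_sub_cancel, id]
      push_cast
      ring
    have h := intervalIntegral.integral_eq_sub_of_hasDerivAt hd
      ((by fun_prop : Continuous _).intervalIntegrable _ _)
    rw [intervalIntegral.integral_sub ((by fun_prop : Continuous _).intervalIntegrable _ _)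
      ((by fun_prop : Continuous _).intervalIntegrable _ _), intervalIntegral.integral_const_mul,
      intervalIntegral.integral_const_mul] at h
    simp only [sub_self, ne_eq, Nat.add_eq_zero_iff, one_ne_zero, and_false, not_false_eq_true,
      zero_pow, mul_zero, zero_mul] at h
    have ih := ih (k + 1)
    have hc : ((k + (l + 1) + 1).choose (k + 1 + 1) : ℝ) * (k + 2) =
        (k + (l + 1) + 1).choose (k + 1) * (l + 1) := by
      have := Nat.choose_succ_right_eq (k + (l + 1) + 1) (k + 1)
      have e : k + (l + 1) + 1 - (k + 1) = l + 1 := by omega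
      rw [e] at this
      exact_mod_cast this
    have e : k + 1 + l + 1 = k + (l + 1) + 1 := by omega
    rw [e] at ih
    push_cast at ih
    have hk1 : (k : ℝ) + 1 ≠ 0 := by positivity
    have hk2 : (k : ℝ) + 1 + 1 ≠ 0 := by positivity
    rw [eq_div_iff hk2] at ih
    rw [eq_div_iff hk1]
    linear_combination ((k + (l + 1) + 1).choose (k + 1) : ℝ) * h + ih -
      (∫ p in (0 : ℝ)..1, p ^ (k + 1) * (1 - p) ^ l) * hc

/-! ### Comparison with harmonic numbers and the final bound -/

theorem abs_log_sub_harmonic_le {a b : ℕ} {c : ℝ} (hc : 0 < c) (ha : c ≤ a) (hb : c ≤ b) :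
    |((harmonic a : ℝ) - Real.log a) - ((harmonic b : ℝ) - Real.log b)| ≤ 1 / c := by
  have key : ∀ k : ℕ, c ≤ k → 0 ≤ (harmonic k : ℝ) - Real.log k - Real.eulerMascheroniConstant ∧
      (harmonic k : ℝ) - Real.log k - Real.eulerMascheroniConstant ≤ 1 / c := by
    intro k hk
    have hk0 : (0 : ℝ) < k := hc.trans_le hk
    have hk' : k ≠ 0 := by
      rintro rfl
      simp at hk0
    have h1 := Real.eulerMascheroniSeq_lt_eulerMascheroniConstant k
    have h2 := Real.eulerMascheroniConstant_lt_eulerMascheroniSeq' k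
    rw [Real.eulerMascheroniSeq] at h1
    rw [Real.eulerMascheroniSeq', if_neg hk'] at h2
    have h3 : Real.log ((k + 1) / k) ≤ (k + 1) / k - 1 := Real.log_le_sub_one_of_pos (by positivity)
    rw [Real.log_div (by positivity) hk0.ne'] at h3
    have h4 : ((k : ℝ) + 1) / k - 1 = 1 / k := by field_simp; ring
    have h5 : 1 / (k : ℝ) ≤ 1 / c := by gcongr
    constructor <;> linarith
  have hA := key a ha
  have hB := key b hb
  rw [abs_le]
  constructor <;> linarith

/-- Types with `m i < j` contribute the factor 1 to both products, so only the others enter the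
telescoping, with common bound `1 - p ^ j`. -/
theorem abs_prod_binomBelow_sub_pow_le {n M j : ℕ} {m : Fin n → ℕ} (hM : ∀ i, m i ≤ M)
    (hj : 1 ≤ j) {p : ℝ} (h0 : 0 ≤ p) (h1 : p ≤ 1) :
    |∏ i, binomBelow (m i) j p - (1 - p ^ j) ^ ∑ i, (m i).choose j| ≤
      ((Finset.univ.filter fun i => j ≤ m i).card : ℝ) *
        ((2 * M * 2 ^ M + (2 ^ M) ^ 2) * p ^ (j + 1) *
          (1 - p ^ j) ^ ((Finset.univ.filter fun i => j ≤ m i).card - 1)) := by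
  have hq0 : 0 ≤ 1 - p ^ j := sub_nonneg.2 (pow_le_one₀ h0 h1)
  have hq1 : 1 - p ^ j ≤ 1 := by linarith [pow_nonneg h0 j]
  have ha : ∏ i, binomBelow (m i) j p =
      ∏ i ∈ Finset.univ.filter fun i => j ≤ m i, binomBelow (m i) j p := by
    refine (Finset.prod_filter_of_ne fun i _ hi => ?_).symm
    by_contra h
    exact hi (binomBelow_eq_one (not_le.1 h) p)
  have hb : (1 - p ^ j) ^ ∑ i, (m i).choose j =
      ∏ i ∈ Finset.univ.filter fun i => j ≤ m i, (1 - p ^ j) ^ (m i).choose j := by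
    rw [← Finset.prod_pow_eq_pow_sum]
    refine (Finset.prod_filter_of_ne fun i _ hi => ?_).symm
    by_contra h
    exact hi (by rw [Nat.choose_eq_zero_of_lt (not_le.1 h), pow_zero])
  rw [ha, hb]
  refine abs_prod_sub_prod_le _ _ _ (fun i _ => binomBelow_nonneg _ _ h0 h1) (fun i hi => ?_)
    (fun i _ => pow_nonneg hq0 _) (fun i hi => ?_) (fun i hi => ?_)
  all_goals have hi := (Finset.mem_filter.1 hi).2
  · exact binomBelow_le hi h0 h1
  · exact pow_le_of_le_one hq0 hq1 (Nat.choose_pos hi).ne'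
  · exact abs_binomBelow_sub_pow_le hj hi (hM i) h0 h1

theorem abs_sum_div_sub_harmonic_le {n M j : ℕ} {m : Fin n → ℕ} (hM : ∀ i, m i ≤ M)
    (hj : 1 ≤ j) (hK : 1 ≤ (Finset.univ.filter fun i => j ≤ m i).card) {q : ℕ → ℝ}
    (hq0 : q 0 = 0)
    (hq : ∀ p, ∑ k ∈ Finset.range ((∑ i, m i) + 1), ((∑ i, m i).choose k : ℝ) *
        (p ^ k * (1 - p) ^ ((∑ i, m i) - k) * q k) = 1 - ∏ i, binomBelow (m i) j p) :
    |∑ k ∈ Finset.range (∑ i, m i), q (k + 1) / ((k : ℝ) + 1) -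
        (harmonic (∑ i, (m i).choose j) : ℝ) / j| ≤
      2 * (2 * M * 2 ^ M + (2 ^ M) ^ 2) *
        (1 / ((Finset.univ.filter fun i => j ≤ m i).card : ℝ)) ^ (1 / (j : ℝ)) := by
  set N := ∑ i, m i
  set A := ∑ i, (m i).choose j with hA
  set K := (Finset.univ.filter fun i => j ≤ m i).card with hKdef
  set C : ℝ := 2 * M * 2 ^ M + (2 ^ M) ^ 2 with hC
  have hj0 : (j : ℝ) ≠ 0 := by positivity
  have hK0 : (K : ℝ) ≠ 0 := by positivity
  -- `R` and `Q` are the two integrands `(1 - ...) / p`, written as polynomials so that nothing is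
  -- singular at 0; `q 0 = 0` and the geometric sum supply the factor `p`.
  let R : ℝ → ℝ := fun p => ∑ k ∈ Finset.range N,
    (N.choose (k + 1) : ℝ) * q (k + 1) * (p ^ k * (1 - p) ^ (N - (k + 1)))
  let Q : ℝ → ℝ := fun p => ∑ s ∈ Finset.range A, p ^ (j - 1) * (1 - p ^ j) ^ s
  have hRc : Continuous R := by fun_prop
  have hQc : Continuous Q := by fun_prop
  have hR : ∫ p in (0 : ℝ)..1, R p = ∑ k ∈ Finset.range N, q (k + 1) / ((k : ℝ) + 1) := by
    rw [intervalIntegral.integral_finsetSum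
      fun k _ => (by fun_prop : Continuous _).intervalIntegrable _ _]
    refine Finset.sum_congr rfl fun k hk => ?_
    obtain ⟨l, hl⟩ := Nat.exists_eq_add_of_lt (Finset.mem_range.1 hk)
    rw [intervalIntegral.integral_const_mul, hl, show k + l + 1 - (k + 1) = l by omega,
      mul_right_comm, integral_pow_mul_one_sub_pow_choose]
    ring
  have hQ : ∫ p in (0 : ℝ)..1, Q p = (harmonic A : ℝ) / j := by
    rw [intervalIntegral.integral_finsetSum
      fun k _ => (by fun_prop : Continuous _).intervalIntegrable _ _, harmonic]
    push_cast
    rw [Finset.sum_div]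
    refine Finset.sum_congr rfl fun s _ => ?_
    rw [integral_pow_mul_one_sub_pow_pow hj, one_div, mul_inv, div_eq_mul_inv, mul_comm]
  have hpR : ∀ p, p * R p = 1 - ∏ i, binomBelow (m i) j p := fun p => by
    rw [← hq, Finset.sum_range_succ', hq0, mul_zero, mul_zero, add_zero, Finset.mul_sum]
    refine Finset.sum_congr rfl fun k _ => ?_
    ring
  have hpQ : ∀ p, p * Q p = 1 - (1 - p ^ j) ^ A := fun p => by
    have h := mul_neg_geom_sum (1 - p ^ j) A
    rw [sub_sub_cancel, Finset.mul_sum] at h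
    rw [← h, Finset.mul_sum]
    refine Finset.sum_congr rfl fun s _ => ?_
    rw [← mul_assoc, ← pow_succ', Nat.sub_add_cancel hj]
  have hbound : ∀ p ∈ Set.Ioc (0 : ℝ) 1,
      ‖R p - Q p‖ ≤ K * C * (p ^ j * (1 - p ^ j) ^ (K - 1)) := fun p hp => by
    have h := abs_prod_binomBelow_sub_pow_le hM hj hp.1.le hp.2
    rw [← hKdef, ← hA, ← hC] at h
    refine le_of_mul_le_mul_left ?_ hp.1
    rw [Real.norm_eq_abs]
    nth_rw 1 [← abs_of_pos hp.1]
    rw [← abs_mul, mul_sub, hpR, hpQ, sub_sub_sub_cancel_left, abs_sub_comm]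
    refine h.trans (le_of_eq ?_)
    ring
  rw [← hR, ← hQ, ← intervalIntegral.integral_sub (hRc.intervalIntegrable _ _)
    (hQc.intervalIntegrable _ _), ← Real.norm_eq_abs]
  refine (intervalIntegral.norm_integral_le_of_norm_le zero_le_one
    (Filter.Eventually.of_forall hbound)
    ((by fun_prop : Continuous _).intervalIntegrable _ _)).trans ?_
  rw [intervalIntegral.integral_const_mul]
  refine (mul_le_mul_of_nonneg_left (integral_pow_mul_one_sub_pow_le hj hK)
    (by positivity)).trans (le_of_eq ?_)
  field_simp

theorem log_gammaMean {n j : ℕ} {m : Fin n → ℕ} (hn : n ≠ 0) (hA : ∑ i, (m i).choose j ≠ 0) :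
    Real.log (gammaMean m j) =
      (Real.log (∑ i, (m i).choose j : ℕ) - Real.log n) / j := by
  have hn' : (n : ℝ) ≠ 0 := by positivity
  have hA' : ((∑ i, (m i).choose j : ℕ) : ℝ) ≠ 0 := by exact_mod_cast hA
  rw [gammaMean, ← Nat.cast_sum, Real.log_rpow (by positivity), Real.log_mul (by positivity) hA',
    one_div (n : ℝ), Real.log_inv]
  ring

theorem abs_greedyValue_sub_le {n M : ℕ} (hn : 2 ≤ n) (hM1 : 1 ≤ M) {m : Fin n → ℕ} {ε : ℝ}
    (hε0 : 0 < ε) (hε1 : ε ≤ 1) (hM : ∀ i, m i ≤ M)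
    (hε : ε * (n : ℝ) ≤ ((Finset.univ.filter fun i => m i = M).card : ℝ)) :
    |greedyValue m - ((harmonic M : ℝ) * (harmonic n : ℝ)
      + ∑ j ∈ Finset.Icc 1 M, Real.log (gammaMean m j))| ≤
      M * ((2 * (2 * M * 2 ^ M + (2 ^ M) ^ 2) + 1) * (1 / ε * (1 / (n : ℝ)) ^ (1 / (M : ℝ)))) := by
  have hn0 : (0 : ℝ) < n := by positivity
  have hn1 : (1 : ℝ) ≤ n := by exact_mod_cast (by omega : 1 ≤ n)
  have hM0 : (0 : ℝ) < M := by positivity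
  have hM1' : (1 : ℝ) ≤ M := by exact_mod_cast hM1
  have hε' : 1 ≤ 1 / ε := by rwa [le_div_iff₀ hε0, one_mul]
  have hεn : 0 < ε * n := by positivity
  obtain ⟨q, hq0, hq, hv⟩ := exists_reach_probability m hM
  have hH : (harmonic M : ℝ) * (harmonic n : ℝ) =
      ∑ j ∈ Finset.Icc 1 M, (harmonic n : ℝ) / j := by
    rw [harmonic_eq_sum_Icc]
    push_cast
    rw [Finset.sum_mul]
    exact Finset.sum_congr rfl fun j _ => by ring
  rw [hv, hH, ← Finset.sum_add_distrib, ← Finset.sum_sub_distrib]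
  refine (Finset.abs_sum_le_sum_abs _ _).trans ?_
  refine (Finset.sum_le_card_nsmul _ _ ((2 * (2 * M * 2 ^ M + (2 ^ M) ^ 2) + 1) *
    (1 / ε * (1 / (n : ℝ)) ^ (1 / (M : ℝ)))) fun j hj => ?_).trans
      (le_of_eq (by rw [Nat.card_Icc, nsmul_eq_mul, Nat.add_sub_cancel]))
  obtain ⟨hj1, hjM⟩ := Finset.mem_Icc.1 hj
  have hj1' : (1 : ℝ) ≤ j := by exact_mod_cast hj1
  set K := (Finset.univ.filter fun i => j ≤ m i).card with hK
  have hKM : (Finset.univ.filter fun i => m i = M).card ≤ K :=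
    Finset.card_le_card (Finset.monotone_filter_right _ fun i _ h => hjM.trans (le_of_eq h.symm))
  have hKε : ε * n ≤ K := hε.trans (by exact_mod_cast hKM)
  have hK0 : (0 : ℝ) < K := hεn.trans_le hKε
  have hK1 : 1 ≤ K := by exact_mod_cast hK0
  have hK1' : (1 : ℝ) ≤ K := by exact_mod_cast hK1
  have hKA : K ≤ ∑ i, (m i).choose j := by
    rw [hK, Finset.card_eq_sum_ones, Finset.sum_filter]
    refine Finset.sum_le_sum fun i _ => ?_
    split_ifs with h
    · exact Nat.choose_pos h
    · exact Nat.zero_le _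
  have hAε : ε * n ≤ (∑ i, (m i).choose j : ℕ) := hKε.trans (by exact_mod_cast hKA)
  have hnε : ε * n ≤ (n : ℕ) := by nlinarith
  have h1 := abs_sum_div_sub_harmonic_le hM hj1 hK1 (hq0 j hj1) (hq j)
  have h2 := abs_log_sub_harmonic_le hεn hAε hnε
  -- As `1 / K ≤ 1`, the worst exponent is the one for `j = M`.
  have e1 : (1 / (K : ℝ)) ^ (1 / (j : ℝ)) ≤ 1 / ε * (1 / (n : ℝ)) ^ (1 / (M : ℝ)) := by
    calc (1 / (K : ℝ)) ^ (1 / (j : ℝ)) ≤ (1 / (K : ℝ)) ^ (1 / (M : ℝ)) := by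
          refine Real.rpow_le_rpow_of_exponent_ge (by positivity) ?_ (by gcongr)
          rwa [div_le_one hK0]
      _ ≤ (1 / ε * (1 / n)) ^ (1 / (M : ℝ)) := by
          rw [one_div_mul_one_div]
          gcongr
      _ = (1 / ε) ^ (1 / (M : ℝ)) * (1 / (n : ℝ)) ^ (1 / (M : ℝ)) :=
          Real.mul_rpow (by positivity) (by positivity)
      _ ≤ _ := by
          gcongr
          refine Real.rpow_le_self_of_one_le hε' ?_
          rwa [div_le_one hM0]
  have e2 : 1 / (ε * n) ≤ 1 / ε * (1 / (n : ℝ)) ^ (1 / (M : ℝ)) := by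
    rw [← one_div_mul_one_div]
    gcongr
    refine Real.self_le_rpow_of_le_one (by positivity) ?_ ?_
    · rwa [div_le_one hn0]
    · rwa [div_le_one hM0]
  rw [log_gammaMean (by omega) (by omega)]
  have heq : (harmonic (∑ i, (m i).choose j) : ℝ) / j -
      ((harmonic n : ℝ) / j + (Real.log (∑ i, (m i).choose j : ℕ) - Real.log n) / j) =
      (((harmonic (∑ i, (m i).choose j) : ℝ) - Real.log (∑ i, (m i).choose j : ℕ)) -
        ((harmonic n : ℝ) - Real.log n)) / j := by ring
  have h3 : |(harmonic (∑ i, (m i).choose j) : ℝ) / j -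
      ((harmonic n : ℝ) / j + (Real.log (∑ i, (m i).choose j : ℕ) - Real.log n) / j)| ≤
      1 / (ε * n) := by
    rw [heq, abs_div, abs_of_pos (zero_lt_one.trans_le hj1')]
    exact (div_le_self (abs_nonneg _) hj1').trans h2
  refine (abs_sub_le _ ((harmonic (∑ i, (m i).choose j) : ℝ) / j) _).trans ?_
  rw [add_mul, one_mul]
  exact add_le_add (h1.trans (by gcongr)) (h3.trans e2)

/-- Since `log n ≥ 1/2` for `n ≥ 2`, each of the two logarithms costs at most a factor 2. -/
theorem one_div_rpow_le_log_mul {n M : ℕ} (hn : 2 ≤ n) (hM : 1 ≤ M) :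
    (1 / (n : ℝ)) ^ (1 / (M : ℝ)) ≤
      4 * (Real.log n * (Real.log n / (n : ℝ)) ^ (1 / (M : ℝ))) := by
  have hn2 : (2 : ℝ) ≤ n := by exact_mod_cast hn
  have hM0 : (0 : ℝ) < M := by positivity
  have hM1 : (1 : ℝ) ≤ M := by exact_mod_cast hM
  have hlog : 1 / 2 ≤ Real.log n :=
    (by linarith [Real.log_two_gt_d9] : 1 / 2 ≤ Real.log 2).trans
      (Real.log_le_log (by norm_num) hn2)
  have h1 : (1 / 2 : ℝ) ≤ (1 / 2) ^ (1 / (M : ℝ)) := by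
    refine Real.self_le_rpow_of_le_one (by norm_num) (by norm_num) ?_
    rwa [div_le_one hM0]
  calc (1 / (n : ℝ)) ^ (1 / (M : ℝ)) =
        4 * (1 / 2 * (1 / 2 * (1 / (n : ℝ)) ^ (1 / (M : ℝ)))) := by ring
    _ ≤ 4 * (Real.log n * ((1 / 2) ^ (1 / (M : ℝ)) * (1 / (n : ℝ)) ^ (1 / (M : ℝ)))) := by gcongr
    _ = 4 * (Real.log n * (1 / 2 / (n : ℝ)) ^ (1 / (M : ℝ))) := by
        rw [← Real.mul_rpow (by norm_num) (by positivity), mul_one_div]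
    _ ≤ _ := by gcongr

end CardGuess

theorem mainTheorem3 (M : ℕ) (hM : 1 ≤ M) (ε : ℝ) (hε0 : 0 < ε) (hε1 : ε ≤ 1) :
    ∃ C : ℝ, ∀ n : ℕ, 2 ≤ n → ∀ m : Fin n → ℕ,
      Finset.univ.sup m = M →
      ε * (n : ℝ) ≤ ((Finset.univ.filter fun i => m i = M).card : ℝ) →
      (∀ σ : CardGuess.Strategy n, CardGuess.IsGreedy m σ → CardGuess.IsBest m σ) ∧
      ∀ σ : CardGuess.Strategy n, CardGuess.IsBest m σ →
        |CardGuess.expectedCorrect m σ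
            - ((harmonic M : ℝ) * (harmonic n : ℝ)
              + ∑ j ∈ Finset.Icc 1 M, Real.log (CardGuess.gammaMean m j))|
          ≤ C * (Real.log n * (Real.log n / (n : ℝ)) ^ (1 / (M : ℝ))) := by
  refine ⟨M * ((2 * (2 * M * 2 ^ M + (2 ^ M) ^ 2) + 1) * (1 / ε * 4)), fun n hn m hsup hε => ?_⟩
  refine ⟨fun σ hσ => hσ.isBest, fun σ hσ => ?_⟩
  have hm : ∀ i, m i ≤ M := fun i => hsup ▸ Finset.le_sup (Finset.mem_univ i)
  rw [hσ.expectedCorrect_eq (by omega)]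
  refine (CardGuess.abs_greedyValue_sub_le hn hM hε0 hε1 hm hε).trans ?_
  rw [mul_assoc (M : ℝ), mul_assoc _ (1 / ε * 4), mul_assoc (1 / ε)]
  gcongr
  exact CardGuess.one_div_rpow_le_log_mul hn hM
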